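/- Consider one bosonic mode with Hilbert space $L^2(\mathbb R)$, position operator $(\hat X\psi)(x)=x\psi(x)$, momentum operator $\hat P=-i\,\frac{d}{dx}$ (so $[\hat X,\hat P]=i$), number operator $\hat N=\frac12(\hat X^2+\hat P^2-\hat I)$ and vacuum state $|0\rangle$ with wave function $\pi^{-1/4}e^{-x^2/2}$. Let $\hat F=e^{i\frac{\pi}{4}(\hat X^2+\hat P^2)}$ be the Fourier gate, or its inverse $\hat F=e^{-i\frac{\pi}{4}(\hat X^2+\hat P^2)}$; the result holds for either sign. For $\theta\in\mathbb R$ let $\hat V^{(3)}(\theta)=e^{i\theta\hat X^3/3}$ be the cubic phase gate, and let $$\hat U_t=\bigl(\hat F\,\hat V^{(3)}(\theta)\bigr)^t,\qquad |\psi_t\rangle=\hat U_t|0\rangle,\qquad t=0,1,2,\dots$$ Then every $|\psi_t\rangle$ lies in the domain of $\hat N$ (so its energy is well defined and finite), and for every $t\ge 0$ $$\langle\psi_t|\hat N|\psi_t\rangle\;\ge\;\frac{1}{4e}\Bigl(\frac{\theta^2}{2e}\Bigr)^{2^t-1}2^{\,t\,2^t}-\frac12 .$$ In particular, if $\theta\neq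 0$ the energy grows at least doubly exponentially in $t$: for every real $C$, $\langle\psi_t|\hat N|\psi_t\rangle\ge C^{2^t}$ for all sufficiently large $t$. -/

import Mathlib

open MeasureTheory

open scoped FourierTransform SchwartzMap InnerProductSpace

noncomputable section

namespace CV

/-- The Hilbert space `L²(ℝ; ℂ)` of one bosonic mode, in the position representation. -/
abbrev Mode : Type := Lp ℂ 2 (volume : Measure ℝ)

/-! ### Position, momentum and number operators -/

/-- The square `T ∘ T` of an unbounded operator, on its natural domain
`{ψ ∈ D(T) | T ψ ∈ D(T)}`. -/
def opSq (T : Mode →ₗ.[ℂ] Mode) : Mode →ₗ.[ℂ] Mode where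
  domain :=
    { carrier := {ψ | ∃ h : ψ ∈ T.domain, T ⟨ψ, h⟩ ∈ T.domain}
      zero_mem' := ⟨T.domain.zero_mem, by
        have : T ⟨0, T.domain.zero_mem⟩ = 0 := T.map_zero
        rw [this]; exact T.domain.zero_mem⟩
      add_mem' := by
        rintro ψ φ ⟨h₁, h₂⟩ ⟨h₃, h₄⟩
        refine ⟨T.domain.add_mem h₁ h₃, ?_⟩
        have : T ⟨ψ + φ, T.domain.add_mem h₁ h₃⟩ = T ⟨ψ, h₁⟩ + T ⟨φ, h₃⟩ :=
          T.map_add ⟨ψ, h₁⟩ ⟨φ, h₃⟩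
        rw [this]; exact T.domain.add_mem h₂ h₄
      smul_mem' := by
        rintro c ψ ⟨h₁, h₂⟩
        refine ⟨T.domain.smul_mem c h₁, ?_⟩
        have : T ⟨c • ψ, T.domain.smul_mem c h₁⟩ = c • T ⟨ψ, h₁⟩ := T.map_smul c ⟨ψ, h₁⟩
        rw [this]; exact T.domain.smul_mem c h₂ }
  toFun :=
    { toFun := fun ψ => T ⟨T ⟨ψ.1, ψ.2.1⟩, ψ.2.2⟩
      map_add' := by
        rintro ⟨ψ, h₁, h₂⟩ ⟨φ, h₃, h₄⟩
        rw [← T.map_add]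
        congr 1
        exact Subtype.ext (T.map_add ⟨ψ, h₁⟩ ⟨φ, h₃⟩)
      map_smul' := by
        rintro c ⟨ψ, h₁, h₂⟩
        rw [RingHom.id_apply, ← T.map_smul]
        congr 1
        exact Subtype.ext (T.map_smul c ⟨ψ, h₁⟩) }

/-- The position operator `(X ψ)(x) = x ψ(x)`, on its maximal domain
`{ψ ∈ L² | x ψ(x) ∈ L²}`. -/
def position : Mode →ₗ.[ℂ] Mode where
  domain :=
    { carrier := {ψ | MemLp (fun x : ℝ => (x : ℂ) * ψ x) 2 volume}
      zero_mem' := by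
        refine (MemLp.zero (ε := ℂ) (p := 2) (μ := (volume : Measure ℝ))).ae_eq ?_
        filter_upwards [Lp.coeFn_zero ℂ 2 (volume : Measure ℝ)] with x hx
        simp only [Pi.zero_apply, hx, mul_zero]
      add_mem' := by
        intro ψ φ h₁ h₂
        refine (h₁.add h₂).ae_eq ?_
        filter_upwards [Lp.coeFn_add ψ φ] with x hx
        simp only [hx, Pi.add_apply, mul_add]
      smul_mem' := by
        intro c ψ h
        refine (h.const_smul c).ae_eq ?_
        filter_upwards [Lp.coeFn_smul c ψ] with x hx
        simp only [hx, Pi.smul_apply, smul_eq_mul, mul_left_comm] }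
  toFun :=
    { toFun := fun ψ => MemLp.toLp (fun x : ℝ => (x : ℂ) * ψ.1 x) ψ.2
      map_add' := by
        intro ψ φ
        rw [← MemLp.toLp_add]
        refine MemLp.toLp_congr _ _ ?_
        filter_upwards [Lp.coeFn_add ψ.1 φ.1] with x hx
        simp only [Submodule.coe_add, hx, Pi.add_apply, mul_add]
      map_smul' := by
        intro c ψ
        rw [RingHom.id_apply, ← MemLp.toLp_const_smul]
        refine MemLp.toLp_congr _ _ ?_
        filter_upwards [Lp.coeFn_smul c ψ.1] with x hx
        simp [hx, mul_left_comm] }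

/-- The differential operator `f ↦ -i f'` on the Schwartz space, as an operator in `L²(ℝ)`. -/
def momentumCore : Mode →ₗ.[ℂ] Mode where
  domain := LinearMap.range (SchwartzMap.toLpCLM ℂ ℂ 2 (volume : Measure ℝ)).toLinearMap
  toFun :=
    ((SchwartzMap.toLpCLM ℂ ℂ 2 (volume : Measure ℝ)).toLinearMap ∘ₗ
        ((-Complex.I) • (SchwartzMap.derivCLM ℂ ℂ).toLinearMap)) ∘ₗ
      (LinearEquiv.ofInjective (SchwartzMap.toLpCLM ℂ ℂ 2 (volume : Measure ℝ)).toLinearMap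
        (SchwartzMap.injective_toLp 2 volume)).symm.toLinearMap

/-- The momentum operator `P = -i d/dx`: the self-adjoint realisation, i.e. the adjoint of
`-i d/dx` on the Schwartz space. Its domain is `{ψ ∈ L² | ψ' ∈ L²}` with `ψ'` the weak
derivative. -/
def momentum : Mode →ₗ.[ℂ] Mode := momentumCore.adjoint

/-- The number operator `N = (X² + P² - I) / 2`, on `D(X²) ∩ D(P²)`. -/
def number : Mode →ₗ.[ℂ] Mode :=
  (1 / 2 : ℂ) • (opSq position + opSq momentum - (LinearMap.id : Mode →ₗ[ℂ] Mode).toPMap ⊤)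

/-- The state `ψ` has a well-defined energy (it lies in the domain of the number operator), and
`⟨ψ| N |ψ⟩ = E`. -/
def HasEnergy (ψ : Mode) (E : ℝ) : Prop :=
  ∃ h : ψ ∈ number.domain, ⟪ψ, number ⟨ψ, h⟩⟫_ℂ = (E : ℂ)

/-! ### The vacuum state -/

lemma memLp_vacuum :
    MemLp (fun x : ℝ => ((Real.pi ^ (-(1 / 4 : ℝ)) * Real.exp (-x ^ 2 / 2) : ℝ) : ℂ)) 2
      volume := by
  have hm : AEStronglyMeasurable
      (fun x : ℝ => ((Real.pi ^ (-(1 / 4 : ℝ)) * Real.exp (-x ^ 2 / 2) : ℝ) : ℂ)) volume :=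
    Continuous.aestronglyMeasurable (by fun_prop)
  rw [memLp_two_iff_integrable_sq_norm hm]
  have := (integrable_exp_neg_mul_sq (b := 1) one_pos).const_mul
    ((Real.pi ^ (-(1 / 4 : ℝ))) ^ 2)
  refine this.congr (Filter.Eventually.of_forall fun x => ?_)
  simp only [Complex.norm_real, Real.norm_eq_abs, sq_abs, mul_pow]
  congr 1
  rw [← Real.exp_nat_mul]
  congr 1
  push_cast
  ring

/-- The vacuum state `|0⟩`, with wave function `π^(-1/4) exp(-x²/2)`. -/
def vacuum : Mode := memLp_vacuum.toLp

/-! ### Gates -/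

lemma memLp_phase {g : ℝ → ℝ} (hg : Measurable g) (ψ : Mode) :
    MemLp (fun x : ℝ => Complex.exp (Complex.I * (g x : ℂ)) * ψ x) 2 volume := by
  refine (Lp.memLp ψ).of_le ?_ (Filter.Eventually.of_forall fun x => ?_)
  · exact (Measurable.aestronglyMeasurable (by fun_prop)).mul (Lp.aestronglyMeasurable ψ)
  · simp [Complex.norm_exp]

lemma norm_phase {g : ℝ → ℝ} (hg : Measurable g) (ψ : Mode) :
    ‖(memLp_phase hg ψ).toLp‖ = ‖ψ‖ := by
  rw [Lp.norm_toLp, Lp.norm_def]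
  congr 1
  refine eLpNorm_congr_norm_ae (Filter.Eventually.of_forall fun x => ?_)
  simp [Complex.norm_exp]

lemma phase_phase {g h : ℝ → ℝ} (hg : Measurable g) (hh : Measurable h)
    (hgh : ∀ x, g x + h x = 0) (ψ : Mode) :
    (memLp_phase hg (memLp_phase hh ψ).toLp).toLp = ψ := by
  refine Lp.ext ?_
  filter_upwards [MemLp.coeFn_toLp (memLp_phase hg (memLp_phase hh ψ).toLp),
    MemLp.coeFn_toLp (memLp_phase hh ψ)] with x h₁ h₂
  rw [h₁, h₂, ← mul_assoc, ← Complex.exp_add, ← mul_add, ← Complex.ofReal_add, hgh]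
  simp

/-- The unitary `e^{i g(X)}`: multiplication of the wave function by `e^{i g(x)}`. -/
def phase (g : ℝ → ℝ) (hg : Measurable g) : Mode ≃ₗᵢ[ℂ] Mode where
  toFun ψ := (memLp_phase hg ψ).toLp
  invFun ψ := (memLp_phase hg.neg ψ).toLp
  map_add' ψ φ := by
    rw [← MemLp.toLp_add]
    refine MemLp.toLp_congr _ _ ?_
    filter_upwards [Lp.coeFn_add ψ φ] with x hx
    simp only [hx, Pi.add_apply, mul_add]
  map_smul' c ψ := by
    rw [RingHom.id_apply, ← MemLp.toLp_const_smul]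
    refine MemLp.toLp_congr _ _ ?_
    filter_upwards [Lp.coeFn_smul c ψ] with x hx
    simp [hx, mul_left_comm]
  left_inv ψ := phase_phase hg.neg hg (by simp) ψ
  right_inv ψ := phase_phase hg hg.neg (by simp) ψ
  norm_map' ψ := norm_phase hg ψ

/-- The phase gate `V^{(k)}(θ) = e^{i θ X^k / k}`; the cubic phase gate is `k = 3`. -/
def phaseGate (k : ℕ) (θ : ℝ) : Mode ≃ₗᵢ[ℂ] Mode :=
  phase (fun x => θ * x ^ k / k) (by fun_prop)

lemma quasiMeasurePreserving_dilation {a : ℝ} (ha : 0 < a) :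
    Measure.QuasiMeasurePreserving (fun x : ℝ => a * x) volume volume :=
  ⟨by fun_prop, by
    rw [Real.map_volume_mul_left ha.ne']
    exact Measure.smul_absolutelyContinuous⟩

lemma aestronglyMeasurable_dilation {a : ℝ} (ha : 0 < a) (ψ : Mode) :
    AEStronglyMeasurable (fun x : ℝ => ((√a : ℝ) : ℂ) * ψ (a * x)) volume :=
  ((Lp.aestronglyMeasurable ψ).comp_quasiMeasurePreserving
    (quasiMeasurePreserving_dilation ha)).const_mul _

lemma eLpNorm_dilation {a : ℝ} (ha : 0 < a) (ψ : Mode) :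
    eLpNorm (fun x : ℝ => ((√a : ℝ) : ℂ) * ψ (a * x)) 2 volume = eLpNorm ψ 2 volume := by
  have h1 : eLpNorm (fun x : ℝ => ψ (a * x)) 2 volume
      = ENNReal.ofReal (√a)⁻¹ * eLpNorm ψ 2 volume := by
    have hm := Real.map_volume_mul_left ha.ne'
    have h := eLpNorm_map_measure (p := 2) (μ := (volume : Measure ℝ)) (f := fun x : ℝ => a * x)
      (g := ψ) (by rw [hm]; exact (Lp.aestronglyMeasurable ψ).smul_measure _) (by fun_prop)
    rw [hm, eLpNorm_smul_measure_of_ne_top (by simp)] at h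
    have h' : (fun x : ℝ => ψ (a * x)) = ψ ∘ fun x : ℝ => a * x := rfl
    rw [h', ← h, smul_eq_mul, ENNReal.ofReal_rpow_of_nonneg (abs_nonneg _) (by positivity)]
    congr 2
    rw [abs_of_pos (inv_pos.2 ha), ← Real.sqrt_inv, Real.sqrt_eq_rpow]
    norm_num
  have h2 : (fun x : ℝ => ((√a : ℝ) : ℂ) * ψ (a * x))
      = ((√a : ℝ) : ℂ) • fun x : ℝ => ψ (a * x) := rfl
  have hs : 0 < √a := Real.sqrt_pos.2 ha
  rw [h2, eLpNorm_const_smul, h1, ← mul_assoc, ← ofReal_norm, Complex.norm_real,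
    Real.norm_of_nonneg hs.le, ← ENNReal.ofReal_mul hs.le, mul_inv_cancel₀ hs.ne']
  simp

lemma memLp_dilation {a : ℝ} (ha : 0 < a) (ψ : Mode) :
    MemLp (fun x : ℝ => ((√a : ℝ) : ℂ) * ψ (a * x)) 2 volume :=
  ⟨aestronglyMeasurable_dilation ha ψ, by
    rw [eLpNorm_dilation ha]; exact (Lp.memLp ψ).2⟩

lemma dilation_dilation {a b : ℝ} (ha : 0 < a) (hb : 0 < b) (hab : b * a = 1) (ψ : Mode) :
    (memLp_dilation ha (memLp_dilation hb ψ).toLp).toLp = ψ := by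
  refine Lp.ext ?_
  filter_upwards [MemLp.coeFn_toLp (memLp_dilation ha (memLp_dilation hb ψ).toLp),
    (quasiMeasurePreserving_dilation ha).ae (MemLp.coeFn_toLp (memLp_dilation hb ψ))] with x h₁ h₂
  rw [h₁, h₂, ← mul_assoc, ← mul_assoc, hab, one_mul, ← Complex.ofReal_mul,
    ← Real.sqrt_mul ha.le, mul_comm a b, hab]
  simp

/-- The unitary dilation `(D_a ψ)(x) = √a ψ(a x)`, for `a > 0`. -/
def dilation (a : ℝ) (ha : 0 < a) : Mode ≃ₗᵢ[ℂ] Mode where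
  toFun ψ := (memLp_dilation ha ψ).toLp
  invFun ψ := (memLp_dilation (inv_pos.2 ha) ψ).toLp
  map_add' ψ φ := by
    rw [← MemLp.toLp_add]
    refine MemLp.toLp_congr _ _ ?_
    filter_upwards [(quasiMeasurePreserving_dilation ha).ae (Lp.coeFn_add ψ φ)] with x hx
    simp only [hx, Pi.add_apply, mul_add]
  map_smul' c ψ := by
    rw [RingHom.id_apply, ← MemLp.toLp_const_smul]
    refine MemLp.toLp_congr _ _ ?_
    filter_upwards [(quasiMeasurePreserving_dilation ha).ae (Lp.coeFn_smul c ψ)] with x hx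
    simp only [hx, Pi.smul_apply, smul_eq_mul, mul_left_comm]
  left_inv ψ := dilation_dilation (inv_pos.2 ha) ha (mul_inv_cancel₀ ha.ne') ψ
  right_inv ψ := dilation_dilation ha (inv_pos.2 ha) (inv_mul_cancel₀ ha.ne') ψ
  norm_map' ψ := by
    change ‖(memLp_dilation ha ψ).toLp‖ = ‖ψ‖
    rw [Lp.norm_toLp, Lp.norm_def, eLpNorm_dilation ha]

/-- The unitary Fourier transform from the position to the momentum representation,
`(Φ ψ)(p) = (2π)^(-1/2) ∫ e^{-ipx} ψ(x) dx`, obtained from Mathlib's `L²` Fourier transform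
`(𝓕 ψ)(ξ) = ∫ e^{-2πiξx} ψ(x) dx` by `p = 2πξ`. -/
def unitaryFourier : Mode ≃ₗᵢ[ℂ] Mode :=
  dilation (2 * Real.pi)⁻¹ (by positivity) * Lp.fourierTransformₗᵢ ℝ ℂ

/-- The integral formula for the unitary Fourier transform, on Schwartz functions. -/
lemma unitaryFourier_toLp (f : 𝓢(ℝ, ℂ)) :
    (unitaryFourier (f.toLp 2 volume) : ℝ → ℂ) =ᵐ[volume] fun p =>
      (((2 * Real.pi) ^ (-(1 / 2 : ℝ)) : ℝ) : ℂ) * ∫ x : ℝ, Complex.exp (-Complex.I * p * x) * f x := by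
  have h0 : Lp.fourierTransformₗᵢ ℝ ℂ (f.toLp 2 volume) = (𝓕 f).toLp 2 :=
    SchwartzMap.toLp_fourier_eq f
  have ha : 0 < (2 * Real.pi)⁻¹ := by positivity
  have h1 : unitaryFourier (f.toLp 2 volume) = (memLp_dilation ha ((𝓕 f).toLp 2)).toLp := by
    rw [← h0]; rfl
  rw [h1]
  filter_upwards [MemLp.coeFn_toLp (memLp_dilation ha ((𝓕 f).toLp 2)),
    (quasiMeasurePreserving_dilation ha).ae (SchwartzMap.coeFn_toLp (𝓕 f) 2 volume)] with p h2 h3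
  rw [h2, h3, SchwartzMap.fourier_coe, Real.fourier_real_eq_integral_exp_smul]
  congr 2
  · rw [Real.sqrt_eq_rpow, Real.inv_rpow (by positivity), Real.rpow_neg (by positivity)]
  · ext x
    rw [smul_eq_mul]
    congr 2
    push_cast
    have : (Real.pi : ℂ) ≠ 0 := by exact_mod_cast Real.pi_ne_zero
    field_simp

/-- The Fourier gate `F = e^{i (π/4) (X² + P²)}`. The harmonic-oscillator evolution over a quarter
period, with Hamiltonian `(X² + P²) / 2`, is `e^{-i (π/4) (X² + P²)} = e^{-iπ/4} Φ`; hence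
`F = e^{iπ/4} Φ⁻¹` and `F⁻¹ = e^{-i (π/4) (X² + P²)}`. -/
def fourierGate : Mode ≃ₗᵢ[ℂ] Mode :=
  phase (fun _ => Real.pi / 4) measurable_const * unitaryFourier⁻¹

/-- The circuit `U_t = (F V^{(3)}(θ))^t`, where `F` is the Fourier gate (either sign of the exponent). -/
def circuit (F : Mode ≃ₗᵢ[ℂ] Mode) (θ : ℝ) (t : ℕ) : Mode ≃ₗᵢ[ℂ] Mode :=
  (F * phaseGate 3 θ) ^ t

end CV

end

noncomputable section

namespace CV

/-! The argument runs in the Heisenberg picture. Conjugation by the Fourier gate sends `X` to `±P`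
and `P` to `∓X`, and conjugation by the cubic gate fixes `X` and sends `P` to `P + θX²`. Hence `U_t†
X U_t` and `U_t† P U_t` become operators `A_t`, `B_t` with `A_{t+1} = s(B_t + θ A_t²)` and `B_{t+1}
= -s A_t`, where `s = ±1`: each step squares the position operator, so its degree in `X`, `P`
doubles (`exists_heisenberg_quadratures`).

Applied to the vacuum, `A_t` gives a polynomial of degree at most `n = 2^t` times the Gaussian. Both
`X` and `P` raise the degree by one, with leading factors of modulus 1, and the term `B_t` has too
low a degree to contribute, so the coefficient of degree `n` has modulus `|θ|^(n-1)` exactly.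
Pairing with the `n`-th Hermite state reads off that coefficient, and Cauchy–Schwarz bounds the norm
from below (`factorial_mul_norm_coeff_sq_le`). Since the energy is at least `(‖X U_t|0⟩‖² - 1)/2`
and `‖X U_t|0⟩‖ = ‖A_t|0⟩‖`, it is at least `n! θ^(2(n-1)) / 2^(n+1) - 1/2` (`exists_energy_ge`).
The stated bound follows from `n! ≥ (n/e)^n`.

All domain questions are settled by staying in the Schwartz space: it contains the vacuum, is
preserved by every gate, and lies in the domain of the number operator. -/

/-! ### Position and momentum on Schwartz functions -/

/-- The inclusion of the Schwartz space in `L²(ℝ)`. -/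
abbrev schwartzState : 𝓢(ℝ, ℂ) →ₗ[ℂ] Mode :=
  (SchwartzMap.toLpCLM ℂ ℂ 2 (volume : Measure ℝ)).toLinearMap

lemma coeFn_schwartzState (f : 𝓢(ℝ, ℂ)) : (schwartzState f : ℝ → ℂ) =ᵐ[volume] f :=
  SchwartzMap.coeFn_toLp f 2 volume

lemma schwartzState_eq_toLp {f : 𝓢(ℝ, ℂ)} {g : ℝ → ℂ} (hg : MemLp g 2 volume)
    (h : g =ᵐ[volume] f) : hg.toLp = schwartzState f := by
  refine Lp.ext ?_
  filter_upwards [hg.coeFn_toLp, coeFn_schwartzState f, h] with x h₁ h₂ h₃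
  rw [h₁, h₂, h₃]

lemma inner_schwartzState (f g : 𝓢(ℝ, ℂ)) :
    ⟪schwartzState f, schwartzState g⟫_ℂ = ∫ x, ⟪f x, g x⟫_ℂ :=
  SchwartzMap.inner_toL2_toL2_eq f g volume

/-- Multiplication by `x` on Schwartz functions. -/
def schwartzX : 𝓢(ℝ, ℂ) →ₗ[ℂ] 𝓢(ℝ, ℂ) :=
  (SchwartzMap.smulLeftCLM ℂ (fun x : ℝ => (x : ℂ))).toLinearMap

/-- The operator `-i d/dx` on Schwartz functions. -/
def schwartzP : 𝓢(ℝ, ℂ) →ₗ[ℂ] 𝓢(ℝ, ℂ) :=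
  (-Complex.I) • (SchwartzMap.derivCLM ℂ ℂ).toLinearMap

@[simp]
lemma schwartzX_apply (f : 𝓢(ℝ, ℂ)) (x : ℝ) : schwartzX f x = x * f x :=
  SchwartzMap.smulLeftCLM_apply_apply (by fun_prop) f x

@[simp]
lemma schwartzP_apply (f : 𝓢(ℝ, ℂ)) (x : ℝ) : schwartzP f x = -Complex.I * deriv f x := rfl

lemma inner_schwartzX (f g : 𝓢(ℝ, ℂ)) :
    ⟪schwartzState f, schwartzState (schwartzX g)⟫_ℂ
      = ⟪schwartzState (schwartzX f), schwartzState g⟫_ℂ := by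
  rw [inner_schwartzState, inner_schwartzState]
  congr 1 with x
  simp only [schwartzX_apply, RCLike.inner_apply, map_mul, Complex.conj_ofReal]
  ring

/-- Integration by parts; its sign is absorbed by the conjugation of `-i`. -/
lemma inner_schwartzP (f g : 𝓢(ℝ, ℂ)) :
    ⟪schwartzState f, schwartzState (schwartzP g)⟫_ℂ
      = ⟪schwartzState (schwartzP f), schwartzState g⟫_ℂ := by
  rw [inner_schwartzState, inner_schwartzState]
  have h := SchwartzMap.integral_bilinear_deriv_right_eq_neg_left f g
    ((ContinuousLinearMap.mul ℝ ℂ).comp (Complex.conjCLE : ℂ →L[ℝ] ℂ))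
  simp only [ContinuousLinearMap.comp_apply, ContinuousLinearMap.mul_apply',
    ContinuousLinearEquiv.coe_coe, Complex.conjCLE_apply] at h
  have h₁ : ∫ x, ⟪f x, schwartzP g x⟫_ℂ
      = -Complex.I * ∫ x, (starRingEnd ℂ) (f x) * deriv g x := by
    rw [← integral_const_mul]
    congr 1 with x
    simp only [schwartzP_apply, RCLike.inner_apply]
    ring
  have h₂ : ∫ x, ⟪schwartzP f x, g x⟫_ℂ
      = Complex.I * ∫ x, (starRingEnd ℂ) (deriv f x) * g x := by
    rw [← integral_const_mul]
    congr 1 with x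
    simp only [schwartzP_apply, RCLike.inner_apply, map_mul, map_neg, Complex.conj_I]
    ring
  rw [h₁, h₂, h]
  ring

/-! ### Energy of Schwartz states -/

lemma schwartzState_mem_position (f : 𝓢(ℝ, ℂ)) : schwartzState f ∈ position.domain := by
  refine (SchwartzMap.memLp (schwartzX f) 2 volume).ae_eq ?_
  filter_upwards [coeFn_schwartzState f] with x hx
  rw [hx, schwartzX_apply]

lemma position_schwartzState (f : 𝓢(ℝ, ℂ)) (h : schwartzState f ∈ position.domain) :
    position ⟨schwartzState f, h⟩ = schwartzState (schwartzX f) := by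
  refine schwartzState_eq_toLp h ?_
  filter_upwards [coeFn_schwartzState f] with x hx
  rw [hx, schwartzX_apply]

/-- Density makes the value of the adjoint unique, so it can be identified by its inner products
alone. -/
lemma dense_momentumCore : Dense (momentumCore.domain : Set Mode) := by
  have := SchwartzMap.denseRange_toLpCLM (E := ℝ) (F := ℂ) (p := 2) (μ := volume)
    ENNReal.ofNat_ne_top
  exact this

lemma momentumCore_apply (g : 𝓢(ℝ, ℂ)) (h : schwartzState g ∈ momentumCore.domain) :
    momentumCore ⟨schwartzState g, h⟩ = schwartzState (schwartzP g) := by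
  have : (LinearEquiv.ofInjective schwartzState
      (SchwartzMap.injective_toLp 2 volume)).symm ⟨schwartzState g, h⟩ = g := by
    rw [LinearEquiv.symm_apply_eq]
    rfl
  change schwartzState (schwartzP ((LinearEquiv.ofInjective schwartzState
      (SchwartzMap.injective_toLp 2 volume)).symm ⟨schwartzState g, h⟩)) = _
  rw [this]

lemma inner_momentumCore (f : 𝓢(ℝ, ℂ)) (y : momentumCore.domain) :
    ⟪schwartzState (schwartzP f), (y : Mode)⟫_ℂ = ⟪schwartzState f, momentumCore y⟫_ℂ := by
  obtain ⟨_, hy⟩ := y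
  obtain ⟨g, rfl⟩ := id hy
  exact ((congrArg _ (momentumCore_apply g hy)).trans (inner_schwartzP f g)).symm

lemma schwartzState_mem_momentum (f : 𝓢(ℝ, ℂ)) : schwartzState f ∈ momentum.domain :=
  LinearPMap.mem_adjoint_domain_of_exists _ ⟨_, inner_momentumCore f⟩

lemma momentum_schwartzState (f : 𝓢(ℝ, ℂ)) (h : schwartzState f ∈ momentum.domain) :
    momentum ⟨schwartzState f, h⟩ = schwartzState (schwartzP f) :=
  LinearPMap.adjoint_apply_eq dense_momentumCore _ (inner_momentumCore f)

lemma opSq_schwartzState {T : Mode →ₗ.[ℂ] Mode} {S : 𝓢(ℝ, ℂ) → 𝓢(ℝ, ℂ)}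
    (hT : ∀ f, schwartzState f ∈ T.domain)
    (hS : ∀ f (h : schwartzState f ∈ T.domain), T ⟨schwartzState f, h⟩ = schwartzState (S f))
    (f : 𝓢(ℝ, ℂ)) :
    ∃ h : schwartzState f ∈ (opSq T).domain,
      opSq T ⟨schwartzState f, h⟩ = schwartzState (S (S f)) := by
  have h : schwartzState f ∈ (opSq T).domain := ⟨hT f, by rw [hS]; exact hT _⟩
  refine ⟨h, ?_⟩
  change T ⟨T ⟨schwartzState f, h.1⟩, h.2⟩ = _
  rw [← hS _ (hT _)]
  congr 1
  exact Subtype.ext (hS _ _)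

/-- Every Schwartz state has an energy, given by the second moments of position and momentum. -/
lemma hasEnergy_schwartzState (f : 𝓢(ℝ, ℂ)) :
    HasEnergy (schwartzState f) ((‖schwartzState (schwartzX f)‖ ^ 2
      + ‖schwartzState (schwartzP f)‖ ^ 2 - ‖schwartzState f‖ ^ 2) / 2) := by
  obtain ⟨hX, hX'⟩ := opSq_schwartzState schwartzState_mem_position position_schwartzState f
  obtain ⟨hP, hP'⟩ := opSq_schwartzState schwartzState_mem_momentum momentum_schwartzState f
  have h : schwartzState f ∈ number.domain := ⟨⟨hX, hP⟩, trivial⟩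
  refine ⟨h, ?_⟩
  have hN : number ⟨schwartzState f, h⟩
      = (1 / 2 : ℂ) • (schwartzState (schwartzX (schwartzX f))
        + schwartzState (schwartzP (schwartzP f)) - schwartzState f) := by
    rw [← hX', ← hP']
    rfl
  rw [hN, inner_smul_right, inner_sub_right, inner_add_right, inner_schwartzX, inner_schwartzP,
    inner_self_eq_norm_sq_to_K, inner_self_eq_norm_sq_to_K, inner_self_eq_norm_sq_to_K]
  simp only [Complex.coe_algebraMap]
  push_cast
  ring

/-! ### The gates on Schwartz functions -/

/-- Every derivative is a power of `i` times the function itself, hence bounded by 1. Composition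
with a polynomial phase then keeps temperate growth, so the cubic gate preserves the Schwartz space.
-/
lemma hasTemperateGrowth_exp_mul_I :
    Function.HasTemperateGrowth (fun s : ℝ => Complex.exp (Complex.I * (s : ℂ))) := by
  refine ⟨(contDiff_const.mul Complex.ofRealCLM.contDiff).cexp, fun n => ⟨0, 1, fun x => ?_⟩⟩
  rw [norm_iteratedFDeriv_eq_norm_iteratedDeriv]
  have h : ∀ n : ℕ, iteratedDeriv n (fun s : ℝ => Complex.exp (Complex.I * (s : ℂ)))
      = fun s : ℝ => Complex.I ^ n * Complex.exp (Complex.I * (s : ℂ)) := by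
    intro n
    induction n with
    | zero => simp
    | succ n ih =>
      rw [iteratedDeriv_succ, ih]
      ext s
      have h₁ : HasDerivAt (fun s : ℝ => Complex.I * (s : ℂ)) (Complex.I * 1) s :=
        (Complex.ofRealCLM.hasDerivAt).const_mul _
      have h₂ := (h₁.cexp.const_mul (Complex.I ^ n)).deriv
      rw [h₂]
      ring
  rw [h n]
  simp [Complex.norm_exp]

/-- Multiplication of Schwartz functions by `e^{i g(x)}`. -/
def schwartzPhase (g : ℝ → ℝ) : 𝓢(ℝ, ℂ) →ₗ[ℂ] 𝓢(ℝ, ℂ) :=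
  (SchwartzMap.smulLeftCLM ℂ (fun x : ℝ => Complex.exp (Complex.I * (g x : ℂ)))).toLinearMap

lemma schwartzPhase_apply {g : ℝ → ℝ} (hg : g.HasTemperateGrowth) (f : 𝓢(ℝ, ℂ)) (x : ℝ) :
    schwartzPhase g f x = Complex.exp (Complex.I * (g x : ℂ)) * f x :=
  SchwartzMap.smulLeftCLM_apply_apply (hasTemperateGrowth_exp_mul_I.comp hg) f x

lemma phase_schwartzState {g : ℝ → ℝ} (hg : g.HasTemperateGrowth) (hm : Measurable g)
    (f : 𝓢(ℝ, ℂ)) : phase g hm (schwartzState f) = schwartzState (schwartzPhase g f) := by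
  refine schwartzState_eq_toLp (memLp_phase hm (schwartzState f)) ?_
  filter_upwards [coeFn_schwartzState f] with x hx
  rw [hx, schwartzPhase_apply hg]

/-- The cubic phase gate on Schwartz functions. -/
abbrev schwartzCubic (θ : ℝ) : 𝓢(ℝ, ℂ) →ₗ[ℂ] 𝓢(ℝ, ℂ) :=
  schwartzPhase (fun x => θ * x ^ 3 / (3 : ℕ))

lemma hasTemperateGrowth_cubic (θ : ℝ) :
    Function.HasTemperateGrowth (fun x : ℝ => θ * x ^ 3 / (3 : ℕ)) := by
  simp only [div_eq_mul_inv]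
  fun_prop

lemma phaseGate_schwartzState (θ : ℝ) (f : 𝓢(ℝ, ℂ)) :
    phaseGate 3 θ (schwartzState f) = schwartzState (schwartzCubic θ f) :=
  phase_schwartzState (hasTemperateGrowth_cubic θ) _ f

lemma schwartzX_schwartzCubic (θ : ℝ) (f : 𝓢(ℝ, ℂ)) :
    schwartzX (schwartzCubic θ f) = schwartzCubic θ (schwartzX f) := by
  ext x
  simp only [schwartzX_apply, schwartzPhase_apply (hasTemperateGrowth_cubic θ)]
  ring

/-- The relation `V† P V = P + θX²`: differentiating the phase brings down `iθx²`. This is the only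
source of degree growth in the circuit. -/
lemma schwartzP_schwartzCubic (θ : ℝ) (f : 𝓢(ℝ, ℂ)) :
    schwartzP (schwartzCubic θ f)
      = schwartzCubic θ (schwartzP f + (θ : ℂ) • schwartzX (schwartzX f)) := by
  ext x
  have h₁ : HasDerivAt (fun x : ℝ => θ * x ^ 3 / (3 : ℕ)) (θ * x ^ 2) x := by
    refine (((hasDerivAt_pow 3 x).const_mul θ).div_const ((3 : ℕ) : ℝ)).congr_deriv ?_
    push_cast
    ring
  have h₂ := ((h₁.ofReal_comp.const_mul Complex.I).cexp.mul (f.hasDerivAt x)).deriv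
  have h₃ : (schwartzCubic θ f : ℝ → ℂ) = fun x : ℝ =>
      Complex.exp (Complex.I * ((θ * x ^ 3 / (3 : ℕ) : ℝ) : ℂ)) * f x :=
    funext fun x => schwartzPhase_apply (hasTemperateGrowth_cubic θ) f x
  rw [schwartzP_apply, h₃]
  erw [h₂]
  rw [schwartzPhase_apply (hasTemperateGrowth_cubic θ)]
  simp only [add_apply, smul_apply, schwartzP_apply, schwartzX_apply,
    smul_eq_mul]
  push_cast
  linear_combination (-Complex.exp (Complex.I * ((θ:ℂ) * x ^ 3 / 3)) * θ * x ^ 2 * f x) * Complex.I_sq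

/-! ### The Fourier gate on Schwartz functions -/

lemma gate_mul_apply (U V : Mode ≃ₗᵢ[ℂ] Mode) (ψ : Mode) : (U * V) ψ = U (V ψ) := rfl

/-- The unitary `U` maps a Schwartz function `f` to the Schwartz function `G f`, and conjugation by
it rotates the quadratures: `X U = s U P` and `P U = -s U X`. -/
structure RotatesQuadratures (U : Mode ≃ₗᵢ[ℂ] Mode) (G : 𝓢(ℝ, ℂ) →ₗ[ℂ] 𝓢(ℝ, ℂ)) (s : ℂ) :
    Prop where
  sign_mul_self : s * s = 1
  apply_schwartzState : ∀ f, U (schwartzState f) = schwartzState (G f)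
  schwartzX_apply : ∀ f, schwartzX (G f) = s • G (schwartzP f)
  schwartzP_apply : ∀ f, schwartzP (G f) = -s • G (schwartzX f)

lemma injective_schwartzState : Function.Injective schwartzState :=
  SchwartzMap.injective_toLp 2 volume

lemma RotatesQuadratures.injective {U : Mode ≃ₗᵢ[ℂ] Mode} {G : 𝓢(ℝ, ℂ) →ₗ[ℂ] 𝓢(ℝ, ℂ)} {s : ℂ}
    (h : RotatesQuadratures U G s) : Function.Injective G := by
  intro f g hfg
  refine injective_schwartzState (U.injective ?_)
  rw [h.apply_schwartzState, h.apply_schwartzState, hfg]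

/-- A right inverse suffices: `G` is injective, so each relation for `G'` may be checked after
applying `G`, where it becomes a relation for `G` with `s² = 1`. -/
lemma RotatesQuadratures.inv {U : Mode ≃ₗᵢ[ℂ] Mode} {G G' : 𝓢(ℝ, ℂ) →ₗ[ℂ] 𝓢(ℝ, ℂ)} {s : ℂ}
    (h : RotatesQuadratures U G s) (hG : ∀ f, G (G' f) = f) : RotatesQuadratures U⁻¹ G' (-s) where
  sign_mul_self := by rw [neg_mul_neg, h.sign_mul_self]
  apply_schwartzState f := by
    refine U.injective ?_
    rw [h.apply_schwartzState, hG]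
    exact U.apply_symm_apply _
  schwartzX_apply f := by
    have h₁ := h.schwartzP_apply (G' f)
    rw [hG] at h₁
    refine h.injective ?_
    rw [map_smul, hG, h₁, smul_smul, neg_mul_neg, h.sign_mul_self, one_smul]
  schwartzP_apply f := by
    have h₁ := h.schwartzX_apply (G' f)
    rw [hG] at h₁
    refine h.injective ?_
    rw [map_smul, hG, h₁, smul_smul, neg_neg, h.sign_mul_self, one_smul]

lemma RotatesQuadratures.phase_mul {U : Mode ≃ₗᵢ[ℂ] Mode} {G : 𝓢(ℝ, ℂ) →ₗ[ℂ] 𝓢(ℝ, ℂ)} {s : ℂ}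
    (h : RotatesQuadratures U G s) (c : ℝ) :
    RotatesQuadratures (phase (fun _ => c) measurable_const * U)
      (Complex.exp (Complex.I * (c : ℂ)) • G) s where
  sign_mul_self := h.sign_mul_self
  apply_schwartzState f := by
    rw [gate_mul_apply, h.apply_schwartzState,
      phase_schwartzState (Function.HasTemperateGrowth.const c)]
    congr 1
    ext x
    exact schwartzPhase_apply (Function.HasTemperateGrowth.const c) _ x
  schwartzX_apply f := by
    rw [LinearMap.smul_apply, map_smul, h.schwartzX_apply, LinearMap.smul_apply, smul_comm]
  schwartzP_apply f := by
    rw [LinearMap.smul_apply, map_smul, h.schwartzP_apply, LinearMap.smul_apply, smul_comm]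

/-- The dilation `f ↦ √a f(a x)` on Schwartz functions. -/
def schwartzDilation (a : ℝ) (ha : 0 < a) : 𝓢(ℝ, ℂ) →ₗ[ℂ] 𝓢(ℝ, ℂ) :=
  ((√a : ℝ) : ℂ) • (SchwartzMap.compCLMOfContinuousLinearEquiv ℂ
    (ContinuousLinearEquiv.unitsEquivAut ℝ (Units.mk0 a ha.ne'))).toLinearMap

lemma schwartzDilation_apply {a : ℝ} (ha : 0 < a) (f : 𝓢(ℝ, ℂ)) (x : ℝ) :
    schwartzDilation a ha f x = ((√a : ℝ) : ℂ) * f (a * x) := by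
  rw [mul_comm a x]
  rfl

lemma dilation_schwartzState {a : ℝ} (ha : 0 < a) (f : 𝓢(ℝ, ℂ)) :
    dilation a ha (schwartzState f) = schwartzState (schwartzDilation a ha f) := by
  refine schwartzState_eq_toLp (memLp_dilation ha (schwartzState f)) ?_
  filter_upwards [(quasiMeasurePreserving_dilation ha).ae (coeFn_schwartzState f)] with x hx
  rw [hx, schwartzDilation_apply]

lemma schwartzDilation_schwartzDilation {a b : ℝ} (ha : 0 < a) (hb : 0 < b) (hab : b * a = 1)
    (f : 𝓢(ℝ, ℂ)) : schwartzDilation a ha (schwartzDilation b hb f) = f := by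
  ext x
  rw [schwartzDilation_apply, schwartzDilation_apply, ← mul_assoc, ← mul_assoc, hab, one_mul,
    ← Complex.ofReal_mul, ← Real.sqrt_mul ha.le, mul_comm a b, hab]
  simp

lemma schwartzX_schwartzDilation {a : ℝ} (ha : 0 < a) (f : 𝓢(ℝ, ℂ)) :
    schwartzX (schwartzDilation a ha f) = (a : ℂ)⁻¹ • schwartzDilation a ha (schwartzX f) := by
  ext x
  have : (a : ℂ) ≠ 0 := by exact_mod_cast ha.ne'
  simp only [schwartzX_apply, schwartzDilation_apply, smul_apply, smul_eq_mul,
    Complex.ofReal_mul]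
  field_simp

lemma schwartzP_schwartzDilation {a : ℝ} (ha : 0 < a) (f : 𝓢(ℝ, ℂ)) :
    schwartzP (schwartzDilation a ha f) = (a : ℂ) • schwartzDilation a ha (schwartzP f) := by
  ext x
  have h₁ : (schwartzDilation a ha f : ℝ → ℂ) = fun x => ((√a : ℝ) : ℂ) * f (a * x) :=
    funext fun x => schwartzDilation_apply ha f x
  have h₂ : HasDerivAt (fun x : ℝ => ((√a : ℝ) : ℂ) * f (a * x))
      (((√a : ℝ) : ℂ) * (a • deriv f (a * x))) x := by
    have h₃ : HasDerivAt (fun x : ℝ => a * x) a x := by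
      simpa using (hasDerivAt_id x).const_mul a
    exact ((f.hasDerivAt (a * x)).scomp x h₃).const_mul _
  rw [schwartzP_apply, h₁, h₂.deriv, smul_apply, schwartzDilation_apply, schwartzP_apply,
    Complex.real_smul, smul_eq_mul]
  ring

/-- The factors `2π` here and in `schwartzP_fourier` come from the kernel `e^{-2πiξx}`; the dilation
in `schwartzFourier` cancels them. -/
lemma schwartzX_fourier (f : 𝓢(ℝ, ℂ)) :
    schwartzX (𝓕 f) = (2 * Real.pi : ℂ)⁻¹ • 𝓕 (schwartzP f) := by
  have hpi : (Real.pi : ℂ) ≠ 0 := by exact_mod_cast Real.pi_ne_zero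
  have h := Real.fourier_deriv f.integrable f.differentiable
    (SchwartzMap.derivCLM ℂ ℂ f).integrable
  have h₁ : 𝓕 (schwartzP f) = -Complex.I • 𝓕 (SchwartzMap.derivCLM ℂ ℂ f) :=
    FourierTransform.fourier_smul (-Complex.I) (SchwartzMap.derivCLM ℂ ℂ f)
  rw [h₁]
  ext x
  have h₂ : 𝓕 (SchwartzMap.derivCLM ℂ ℂ f) x = 2 * Real.pi * Complex.I * x * 𝓕 f x :=
    congrFun h x
  rw [smul_apply, smul_apply, h₂, schwartzX_apply, smul_eq_mul, smul_eq_mul]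
  field_simp
  linear_combination (x * 𝓕 f x) * Complex.I_sq

lemma schwartzP_fourier (f : 𝓢(ℝ, ℂ)) :
    schwartzP (𝓕 f) = -(2 * Real.pi : ℂ) • 𝓕 (schwartzX f) := by
  have hint : Integrable (fun x : ℝ => x • f x) := by
    refine (schwartzX f).integrable.congr (Filter.Eventually.of_forall fun x => ?_)
    simp
  have h := Real.deriv_fourier f.integrable hint
  have h₁ : 𝓕 ((-2 * Real.pi * Complex.I) • schwartzX f)
      = (-2 * Real.pi * Complex.I) • 𝓕 (schwartzX f) :=
    FourierTransform.fourier_smul _ _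
  have h₂ : (fun x : ℝ => (-2 * Real.pi * Complex.I * x) • f x)
      = ((-2 * Real.pi * Complex.I) • schwartzX f : 𝓢(ℝ, ℂ)) := by
    ext x
    simp only [smul_apply, smul_eq_mul, schwartzX_apply]
    ring
  rw [h₂, ← SchwartzMap.fourier_coe, ← SchwartzMap.fourier_coe, h₁] at h
  ext x
  rw [schwartzP_apply, congrFun h x, smul_apply, smul_apply, smul_eq_mul, smul_eq_mul]
  linear_combination (2 * Real.pi * 𝓕 (schwartzX f) x) * Complex.I_sq

lemma inv_two_pi_pos : 0 < (2 * Real.pi)⁻¹ := by positivity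

lemma two_pi_pos : 0 < 2 * Real.pi := by positivity

/-- The unitary Fourier transform on Schwartz functions. -/
def schwartzFourier : 𝓢(ℝ, ℂ) →ₗ[ℂ] 𝓢(ℝ, ℂ) :=
  schwartzDilation (2 * Real.pi)⁻¹ inv_two_pi_pos ∘ₗ
    (FourierTransform.fourierEquiv ℂ 𝓢(ℝ, ℂ)).toLinearMap

/-- The inverse unitary Fourier transform on Schwartz functions. -/
def schwartzFourierInv : 𝓢(ℝ, ℂ) →ₗ[ℂ] 𝓢(ℝ, ℂ) :=
  (FourierTransform.fourierEquiv ℂ 𝓢(ℝ, ℂ)).symm.toLinearMap ∘ₗ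
    schwartzDilation (2 * Real.pi) two_pi_pos

lemma schwartzFourier_apply (f : 𝓢(ℝ, ℂ)) :
    schwartzFourier f = schwartzDilation (2 * Real.pi)⁻¹ inv_two_pi_pos (𝓕 f) := rfl

lemma schwartzFourier_schwartzFourierInv (f : 𝓢(ℝ, ℂ)) :
    schwartzFourier (schwartzFourierInv f) = f := by
  simp only [schwartzFourier, schwartzFourierInv, LinearMap.comp_apply, LinearEquiv.coe_coe,
    LinearEquiv.apply_symm_apply]
  exact schwartzDilation_schwartzDilation _ _ (mul_inv_cancel₀ two_pi_pos.ne') f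

lemma schwartzFourierInv_schwartzFourier (f : 𝓢(ℝ, ℂ)) :
    schwartzFourierInv (schwartzFourier f) = f := by
  simp only [schwartzFourier, schwartzFourierInv, LinearMap.comp_apply, LinearEquiv.coe_coe]
  rw [schwartzDilation_schwartzDilation _ _ (inv_mul_cancel₀ two_pi_pos.ne'),
    LinearEquiv.symm_apply_apply]

lemma rotatesQuadratures_unitaryFourier :
    RotatesQuadratures unitaryFourier schwartzFourier 1 where
  sign_mul_self := one_mul 1
  apply_schwartzState f := by
    have h : Lp.fourierTransformₗᵢ ℝ ℂ (schwartzState f) = schwartzState (𝓕 f) :=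
      SchwartzMap.toLp_fourier_eq f
    rw [unitaryFourier, gate_mul_apply, h, dilation_schwartzState,
      schwartzFourier_apply]
  schwartzX_apply f := by
    have hpi : (Real.pi : ℂ) ≠ 0 := by exact_mod_cast Real.pi_ne_zero
    rw [schwartzFourier_apply, schwartzX_schwartzDilation, schwartzX_fourier, map_smul, smul_smul,
      schwartzFourier_apply]
    congr 1
    push_cast
    field_simp
  schwartzP_apply f := by
    have hpi : (Real.pi : ℂ) ≠ 0 := by exact_mod_cast Real.pi_ne_zero
    rw [schwartzFourier_apply, schwartzP_schwartzDilation, schwartzP_fourier, map_smul, smul_smul,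
      schwartzFourier_apply]
    congr 1
    push_cast
    field_simp

/-- Both signs of the Fourier gate rotate the quadratures. -/
lemma exists_rotatesQuadratures {F : Mode ≃ₗᵢ[ℂ] Mode}
    (hF : F = fourierGate ∨ F = fourierGate⁻¹) : ∃ G s, RotatesQuadratures F G s := by
  have h : RotatesQuadratures fourierGate _ _ :=
    (rotatesQuadratures_unitaryFourier.inv schwartzFourier_schwartzFourierInv).phase_mul
      (Real.pi / 4)
  rcases hF with rfl | rfl
  · exact ⟨_, _, h⟩
  · refine ⟨_, _, h.inv
      (G' := (Complex.exp (Complex.I * ((Real.pi / 4 : ℝ) : ℂ)))⁻¹ • schwartzFourier) fun f => ?_⟩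
    rw [LinearMap.smul_apply, LinearMap.smul_apply, map_smul, schwartzFourierInv_schwartzFourier,
      smul_smul, mul_inv_cancel₀ (Complex.exp_ne_zero _), one_smul]

/-! ### The vacuum as a Schwartz function -/

/-- The exponential dominates a single term of its power series; the bound `|x|^m ≤ 1 + (x²)^m`
reduces to even powers. -/
lemma exists_abs_pow_mul_exp_le (m : ℕ) :
    ∃ C : ℝ, ∀ x : ℝ, |x| ^ m * Real.exp (-(x ^ 2 / 2)) ≤ C := by
  refine ⟨1 + 2 ^ m * m.factorial, fun x => ?_⟩
  have h₁ : |x| ^ m ≤ 1 + (x ^ 2) ^ m := by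
    rw [← sq_abs x, ← pow_mul, mul_comm 2 m, pow_mul]
    nlinarith [sq_nonneg (|x| ^ m - 1), pow_nonneg (abs_nonneg x) m]
  have h₂ := Real.pow_div_factorial_le_exp (x ^ 2 / 2) (by positivity) m
  have h₃ : (x ^ 2) ^ m ≤ 2 ^ m * m.factorial * Real.exp (x ^ 2 / 2) := by
    rw [div_pow, div_div, div_le_iff₀ (by positivity)] at h₂
    linarith
  have h₄ : (1 : ℝ) ≤ Real.exp (x ^ 2 / 2) := Real.one_le_exp (by positivity)
  rw [Real.exp_neg, ← div_eq_mul_inv, div_le_iff₀ (Real.exp_pos _)]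
  linarith

lemma exists_abs_pow_mul_polynomial_mul_exp_le (k : ℕ) (p : Polynomial ℝ) :
    ∃ C : ℝ, ∀ x : ℝ, |x| ^ k * (|p.eval x| * Real.exp (-(x ^ 2 / 2))) ≤ C := by
  induction p using Polynomial.induction_on' with
  | add p q hp hq =>
    obtain ⟨C, hC⟩ := hp
    obtain ⟨D, hD⟩ := hq
    refine ⟨C + D, fun x => le_trans ?_ (add_le_add (hC x) (hD x))⟩
    rw [← mul_add, ← add_mul, Polynomial.eval_add]
    gcongr
    exact abs_add_le _ _
  | monomial n a =>
    obtain ⟨C, hC⟩ := exists_abs_pow_mul_exp_le (k + n)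
    refine ⟨|a| * C, fun x => le_trans (le_of_eq ?_) (mul_le_mul_of_nonneg_left (hC x)
      (abs_nonneg a))⟩
    rw [Polynomial.eval_monomial, abs_mul, abs_pow]
    ring

/-- The Gaussian `e^{-x²/2}` as a Schwartz function. -/
def gaussian : 𝓢(ℝ, ℝ) where
  toFun x := Real.exp (-(x ^ 2 / 2))
  smooth' := by fun_prop
  decay' k n := by
    -- The `n`-th derivative of the Gaussian is, up to sign, a Hermite polynomial times the
    -- Gaussian.
    obtain ⟨C, hC⟩ := exists_abs_pow_mul_polynomial_mul_exp_le k
      ((Polynomial.hermite n).map (Int.castRingHom ℝ))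
    refine ⟨C, fun x => le_trans (le_of_eq ?_) (hC x)⟩
    rw [norm_iteratedFDeriv_eq_norm_iteratedDeriv, iteratedDeriv_eq_iterate,
      Polynomial.deriv_gaussian_eq_hermite_mul_gaussian, Polynomial.eval_map,
      Polynomial.aeval_def]
    simp

/-- The vacuum wave function as a Schwartz function. -/
def schwartzVacuum : 𝓢(ℝ, ℂ) :=
  ((Real.pi ^ (-(1 / 4 : ℝ)) : ℝ) : ℂ) • SchwartzMap.postcompCLM (𝕜 := ℝ) Complex.ofRealCLM gaussian

lemma schwartzVacuum_apply (x : ℝ) :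
    schwartzVacuum x = ((Real.pi ^ (-(1 / 4 : ℝ)) * Real.exp (-x ^ 2 / 2) : ℝ) : ℂ) := by
  rw [Complex.ofReal_mul, neg_div]
  rfl

lemma schwartzState_schwartzVacuum : schwartzState schwartzVacuum = vacuum :=
  (schwartzState_eq_toLp memLp_vacuum
    (Filter.Eventually.of_forall fun x => (schwartzVacuum_apply x).symm)).symm

lemma inner_schwartzVacuum :
    ⟪schwartzState schwartzVacuum, schwartzState schwartzVacuum⟫_ℂ = 1 := by
  have h : ∀ x : ℝ, ⟪schwartzVacuum x, schwartzVacuum x⟫_ℂ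
      = ((Real.pi ^ (-(1 / 2 : ℝ)) * Real.exp (-1 * x ^ 2) : ℝ) : ℂ) := by
    intro x
    rw [schwartzVacuum_apply, RCLike.inner_apply, Complex.conj_ofReal, ← Complex.ofReal_mul]
    congr 1
    rw [mul_mul_mul_comm, ← Real.exp_add, ← Real.rpow_add Real.pi_pos]
    congr 2
    · norm_num
    · ring
  rw [inner_schwartzState]
  simp_rw [h]
  rw [integral_complex_ofReal, integral_const_mul, integral_gaussian, div_one, Real.sqrt_eq_rpow,
    ← Real.rpow_add Real.pi_pos]
  norm_num

/-! ### Ladder operators and polynomial states -/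

/-- The annihilation operator `X + i P = √2 a`. -/
def lowering : 𝓢(ℝ, ℂ) →ₗ[ℂ] 𝓢(ℝ, ℂ) := schwartzX + Complex.I • schwartzP

/-- The creation operator `X - i P = √2 a†`. -/
def raising : 𝓢(ℝ, ℂ) →ₗ[ℂ] 𝓢(ℝ, ℂ) := schwartzX - Complex.I • schwartzP

lemma lowering_apply (f : 𝓢(ℝ, ℂ)) (x : ℝ) : lowering f x = x * f x + deriv f x := by
  have : lowering f x = schwartzX f x + Complex.I * schwartzP f x := rfl
  rw [this, schwartzX_apply, schwartzP_apply]
  linear_combination (-deriv f x) * Complex.I_sq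

lemma lowering_schwartzX (f : 𝓢(ℝ, ℂ)) :
    lowering (schwartzX f) = schwartzX (lowering f) + f := by
  ext x
  have h₁ : HasDerivAt (fun x : ℝ => (x : ℂ)) 1 x := Complex.ofRealCLM.hasDerivAt
  have h₂ : (schwartzX f : ℝ → ℂ) = fun x : ℝ => (x : ℂ) * f x := funext (schwartzX_apply f)
  have h₃ : deriv (schwartzX f) x = 1 * f x + x * deriv f x := by
    rw [h₂]
    exact (h₁.mul (f.hasDerivAt x)).deriv
  rw [lowering_apply, h₃, add_apply, schwartzX_apply, schwartzX_apply, lowering_apply]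
  ring

lemma lowering_schwartzVacuum : lowering schwartzVacuum = 0 := by
  ext x
  have h₁ : (schwartzVacuum : ℝ → ℂ) = fun x : ℝ =>
      ((Real.pi ^ (-(1 / 4 : ℝ)) * Real.exp (-x ^ 2 / 2) : ℝ) : ℂ) := funext schwartzVacuum_apply
  have h₂ : HasDerivAt (fun x : ℝ => -x ^ 2 / 2) (-x) x :=
    (((hasDerivAt_pow 2 x).neg).div_const 2).congr_deriv (by push_cast; ring)
  have h₃ := (h₂.exp.const_mul (Real.pi ^ (-(1 / 4 : ℝ)))).ofReal_comp.deriv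
  rw [lowering_apply, h₁, h₃]
  change _ = (0 : ℂ)
  push_cast
  ring

lemma inner_lowering (f g : 𝓢(ℝ, ℂ)) :
    ⟪schwartzState f, schwartzState (lowering g)⟫_ℂ
      = ⟪schwartzState (raising f), schwartzState g⟫_ℂ := by
  simp only [lowering, raising, LinearMap.add_apply, LinearMap.sub_apply, LinearMap.smul_apply,
    map_add, map_sub, map_smul, inner_add_right, inner_sub_left, inner_smul_left,
    inner_smul_right, inner_schwartzX, inner_schwartzP, Complex.conj_I]
  ring

lemma inner_lowering_iterate (n : ℕ) (f g : 𝓢(ℝ, ℂ)) :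
    ⟪schwartzState f, schwartzState (lowering^[n] g)⟫_ℂ
      = ⟪schwartzState (raising^[n] f), schwartzState g⟫_ℂ := by
  induction n generalizing f g with
  | zero => rfl
  | succ n ih =>
    rw [Function.iterate_succ_apply', Function.iterate_succ_apply, inner_lowering, ih]

open Polynomial in
/-- The wave function `p(x) π^(-1/4) e^{-x²/2}` of a polynomial `p`. -/
def polyState : ℂ[X] →ₗ[ℂ] 𝓢(ℝ, ℂ) :=
  LinearMap.applyₗ schwartzVacuum ∘ₗ (aeval (R := ℂ) (A := Module.End ℂ 𝓢(ℝ, ℂ)) schwartzX).toLinearMap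

open Polynomial in
lemma polyState_apply (p : ℂ[X]) :
    polyState p = aeval (R := ℂ) (A := Module.End ℂ 𝓢(ℝ, ℂ)) schwartzX p schwartzVacuum := rfl

@[simp]
lemma polyState_one : polyState 1 = schwartzVacuum := by
  rw [polyState_apply, map_one]
  rfl

open Polynomial in
lemma polyState_C (a : ℂ) : polyState (C a) = a • schwartzVacuum := by
  rw [polyState_apply, aeval_C]
  rfl

open Polynomial in
lemma polyState_X_mul (p : ℂ[X]) : polyState (X * p) = schwartzX (polyState p) := by
  rw [polyState_apply, map_mul, aeval_X]
  rfl

open Polynomial in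
-- `lowering` kills the vacuum and has commutator 1 with `X`, so it acts as a derivation on the
-- polynomial factor.
lemma lowering_polyState (p : ℂ[X]) : lowering (polyState p) = polyState (derivative p) := by
  induction p using Polynomial.induction_on with
  | C a =>
    rw [polyState_C, map_smul, lowering_schwartzVacuum, derivative_C, map_zero, smul_zero]
  | add p q hp hq => rw [map_add, map_add, hp, hq, derivative_add, map_add]
  | monomial n a ih =>
    have h : C a * X ^ (n + 1) = X * (C a * X ^ n) := by ring
    rw [h, polyState_X_mul, lowering_schwartzX, ih, derivative_mul (f := X), derivative_X, one_mul,
      map_add, polyState_X_mul, add_comm]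

open Polynomial in
lemma schwartzP_polyState (p : ℂ[X]) :
    schwartzP (polyState p) = polyState (Complex.I • (X * p - derivative p)) := by
  rw [map_smul, map_sub, polyState_X_mul, ← lowering_polyState, lowering, LinearMap.add_apply,
    LinearMap.smul_apply, sub_add_cancel_left, smul_neg, smul_smul, Complex.I_mul_I, neg_smul,
    one_smul, neg_neg]

open Polynomial in
lemma lowering_iterate_polyState (n : ℕ) (p : ℂ[X]) (hp : p.natDegree ≤ n) :
    lowering^[n] (polyState p) = (n.factorial * p.coeff n : ℂ) • schwartzVacuum := by
  induction n generalizing p with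
  | zero =>
    rw [eq_C_of_natDegree_le_zero hp, polyState_C]
    simp
  | succ n ih =>
    rw [Function.iterate_succ_apply, lowering_polyState, ih _ (by
      have := natDegree_derivative_le p
      omega), coeff_derivative]
    congr 1
    push_cast [Nat.factorial_succ]
    ring

/-- The operator `A` maps polynomial states of degree at most `n` to polynomial states of degree at
most `n + d`, and multiplies the coefficient of top degree by `c`. -/
def HasLeading (A : 𝓢(ℝ, ℂ) →ₗ[ℂ] 𝓢(ℝ, ℂ)) (d : ℕ) (c : ℂ) : Prop :=
  ∀ (n : ℕ) (p : Polynomial ℂ), p.natDegree ≤ n → ∃ q : Polynomial ℂ,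
    q.natDegree ≤ n + d ∧ q.coeff (n + d) = c * p.coeff n ∧ A (polyState p) = polyState q

lemma natDegree_X_mul_le (p : Polynomial ℂ) :
    (Polynomial.X * p).natDegree ≤ p.natDegree + 1 := by
  have := Polynomial.natDegree_mul_le (p := Polynomial.X) (q := p)
  have := Polynomial.natDegree_X_le (R := ℂ)
  omega

lemma hasLeading_schwartzX : HasLeading schwartzX 1 1 := fun n p hp =>
  ⟨Polynomial.X * p, by
    have := natDegree_X_mul_le p
    omega, by rw [Polynomial.coeff_X_mul, one_mul], (polyState_X_mul p).symm⟩

lemma hasLeading_schwartzP : HasLeading schwartzP 1 Complex.I := by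
  intro n p hp
  have h := Polynomial.natDegree_derivative_le p
  refine ⟨_, ?_, ?_, schwartzP_polyState p⟩
  · refine (Polynomial.natDegree_smul_le _ _).trans ((Polynomial.natDegree_sub_le _ _).trans ?_)
    have := natDegree_X_mul_le p
    omega
  · rw [Polynomial.coeff_smul, Polynomial.coeff_sub, Polynomial.coeff_X_mul,
      Polynomial.coeff_eq_zero_of_natDegree_lt (p := Polynomial.derivative p) (by omega), sub_zero,
      smul_eq_mul]

lemma HasLeading.add {A B : 𝓢(ℝ, ℂ) →ₗ[ℂ] 𝓢(ℝ, ℂ)} {d : ℕ} {a b : ℂ} (hA : HasLeading A d a)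
    (hB : HasLeading B d b) : HasLeading (A + B) d (a + b) := by
  intro n p hp
  obtain ⟨q, hq₁, hq₂, hq₃⟩ := hA n p hp
  obtain ⟨r, hr₁, hr₂, hr₃⟩ := hB n p hp
  refine ⟨q + r, Polynomial.natDegree_add_le_of_degree_le hq₁ hr₁, ?_, ?_⟩
  · rw [Polynomial.coeff_add, hq₂, hr₂, add_mul]
  · rw [LinearMap.add_apply, hq₃, hr₃, map_add]

lemma HasLeading.smul {A : 𝓢(ℝ, ℂ) →ₗ[ℂ] 𝓢(ℝ, ℂ)} {d : ℕ} {a : ℂ} (hA : HasLeading A d a)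
    (c : ℂ) : HasLeading (c • A) d (c * a) := by
  intro n p hp
  obtain ⟨q, hq₁, hq₂, hq₃⟩ := hA n p hp
  refine ⟨c • q, (Polynomial.natDegree_smul_le _ _).trans hq₁, ?_, ?_⟩
  · rw [Polynomial.coeff_smul, hq₂, smul_eq_mul, mul_assoc]
  · rw [LinearMap.smul_apply, hq₃, map_smul]

lemma HasLeading.comp {A B : 𝓢(ℝ, ℂ) →ₗ[ℂ] 𝓢(ℝ, ℂ)} {d e : ℕ} {a b : ℂ} (hA : HasLeading A d a)
    (hB : HasLeading B e b) : HasLeading (A ∘ₗ B) (e + d) (a * b) := by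
  intro n p hp
  obtain ⟨q, hq₁, hq₂, hq₃⟩ := hB n p hp
  obtain ⟨r, hr₁, hr₂, hr₃⟩ := hA _ q hq₁
  refine ⟨r, by rwa [← add_assoc], ?_, ?_⟩
  · rw [← add_assoc, hr₂, hq₂, mul_assoc]
  · rw [LinearMap.comp_apply, hq₃, hr₃]

/-- Degrees are only upper bounds, so a lower-order operator counts as one of higher order with
leading factor 0. This discards `B_t` against `θ A_t²`. -/
lemma HasLeading.of_lt {A : 𝓢(ℝ, ℂ) →ₗ[ℂ] 𝓢(ℝ, ℂ)} {d e : ℕ} {a : ℂ} (hA : HasLeading A d a)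
    (h : d < e) : HasLeading A e 0 := by
  intro n p hp
  obtain ⟨q, hq₁, hq₂, hq₃⟩ := hA n p hp
  exact ⟨q, by omega, by rw [zero_mul, Polynomial.coeff_eq_zero_of_natDegree_lt (by omega)], hq₃⟩

lemma hasLeading_raising : HasLeading raising 1 2 := by
  have h := hasLeading_schwartzX.add (hasLeading_schwartzP.smul (-Complex.I))
  have h₁ : (1 : ℂ) + -Complex.I * Complex.I = 2 := by
    rw [neg_mul, Complex.I_mul_I]
    norm_num
  rwa [h₁, neg_smul, ← sub_eq_add_neg] at h

/-- Here `q` is the physicists' Hermite polynomial; only its degree and leading coefficient are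
needed. -/
lemma raising_iterate_schwartzVacuum (n : ℕ) : ∃ q : Polynomial ℂ,
    q.natDegree ≤ n ∧ q.coeff n = 2 ^ n ∧ raising^[n] schwartzVacuum = polyState q := by
  induction n with
  | zero => exact ⟨1, by simp, by simp, by simp⟩
  | succ n ih =>
    obtain ⟨q, hq₁, hq₂, hq₃⟩ := ih
    obtain ⟨r, hr₁, hr₂, hr₃⟩ := hasLeading_raising n q hq₁
    refine ⟨r, hr₁, ?_, ?_⟩
    · rw [hr₂, hq₂, pow_succ']
    · rw [Function.iterate_succ_apply', hq₃, hr₃]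

/-- Among the polynomial states of degree `n` with given leading coefficient, the Hermite states
have the least norm. -/
lemma factorial_mul_norm_coeff_sq_le (n : ℕ) (p : Polynomial ℂ) (hp : p.natDegree ≤ n) :
    n.factorial * ‖p.coeff n‖ ^ 2 ≤ 2 ^ n * ‖schwartzState (polyState p)‖ ^ 2 := by
  obtain ⟨q, hq₁, hq₂, hq₃⟩ := raising_iterate_schwartzVacuum n
  -- Moving `raising^[n]` to the other side turns it into `n` derivatives of `r`, which leave `n!`
  -- times its coefficient of degree `n`.
  have key : ∀ r : Polynomial ℂ, r.natDegree ≤ n →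
      ⟪schwartzState (polyState q), schwartzState (polyState r)⟫_ℂ
        = n.factorial * r.coeff n := by
    intro r hr
    rw [← hq₃, ← inner_lowering_iterate, lowering_iterate_polyState n r hr, map_smul,
      inner_smul_right, inner_schwartzVacuum, mul_one]
  -- The case `r = q` gives the norm of the Hermite state itself.
  have h₁ : ‖schwartzState (polyState q)‖ ^ 2 = n.factorial * 2 ^ n := by
    have h := key q hq₁
    rw [hq₂, inner_self_eq_norm_sq_to_K] at h
    simp only [Complex.coe_algebraMap] at h
    exact_mod_cast h
  have h₂ := norm_inner_le_norm (𝕜 := ℂ) (schwartzState (polyState q)) (schwartzState (polyState p))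
  rw [key p hp, norm_mul, Complex.norm_natCast] at h₂
  have h₃ := pow_le_pow_left₀ (by positivity) h₂ 2
  rw [mul_pow, mul_pow, h₁] at h₃
  have h₄ : (0 : ℝ) < n.factorial := by exact_mod_cast n.factorial_pos
  refine le_of_mul_le_mul_left ?_ h₄
  linarith

/-! ### Heisenberg evolution of the quadratures -/

/-- On Schwartz functions the circuit conjugates position and momentum to operators that raise the
degree of polynomial states by at most `2 ^ t`; for position the leading coefficient has modulus
`|θ| ^ (2 ^ t - 1)`. -/
lemma exists_heisenberg_quadratures {F : Mode ≃ₗᵢ[ℂ] Mode} {G : 𝓢(ℝ, ℂ) →ₗ[ℂ] 𝓢(ℝ, ℂ)} {s : ℂ}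
    (hF : RotatesQuadratures F G s) (θ : ℝ) (t : ℕ) :
    ∃ (U A B : 𝓢(ℝ, ℂ) →ₗ[ℂ] 𝓢(ℝ, ℂ)) (a b : ℂ),
      (∀ f, circuit F θ t (schwartzState f) = schwartzState (U f)) ∧
      (∀ f, schwartzX (U f) = U (A f)) ∧ (∀ f, schwartzP (U f) = U (B f)) ∧
      HasLeading A (2 ^ t) a ∧ HasLeading B (2 ^ t) b ∧ ‖a‖ = |θ| ^ (2 ^ t - 1) := by
  have hs : ‖s‖ = 1 := by
    have h := congrArg norm hF.sign_mul_self
    rw [norm_mul, norm_one] at h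
    nlinarith [norm_nonneg s]
  induction t with
  | zero =>
    refine ⟨LinearMap.id, schwartzX, schwartzP, 1, Complex.I, fun f => ?_, fun f => rfl,
      fun f => rfl, hasLeading_schwartzX, hasLeading_schwartzP, by simp⟩
    rw [circuit, pow_zero]
    rfl
  | succ t ih =>
    obtain ⟨U, A, B, a, b, hU, hX, hP, hA, hB, ha⟩ := ih
    have hlt : 2 ^ t < 2 ^ (t + 1) := Nat.pow_lt_pow_right one_lt_two t.lt_succ_self
    have hAA : HasLeading (A ∘ₗ A) (2 ^ (t + 1)) (a * a) := by
      have h := hA.comp hA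
      rwa [← two_mul, ← pow_succ'] at h
    -- The outermost gates are moved past first: `X` becomes `sP`, then `s(P + θX²)`, and the inner
    -- circuit turns this into `s(B + θA²)`. Likewise `P` becomes `-sX`, then `-sA`.
    refine ⟨G ∘ₗ schwartzCubic θ ∘ₗ U, s • (B + (θ : ℂ) • (A ∘ₗ A)), -s • A, _, _, fun f => ?_,
      fun f => ?_, fun f => ?_, ((hB.of_lt hlt).add (hAA.smul θ)).smul s,
      (hA.of_lt hlt).smul (-s), ?_⟩
    · rw [circuit, pow_succ', gate_mul_apply, gate_mul_apply]
      change F (phaseGate 3 θ (circuit F θ t (schwartzState f))) = _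
      rw [hU, phaseGate_schwartzState, hF.apply_schwartzState]
      rfl
    · simp only [LinearMap.comp_apply, LinearMap.smul_apply, LinearMap.add_apply, map_smul,
        map_add, hF.schwartzX_apply, schwartzP_schwartzCubic, hP, hX]
    · simp only [LinearMap.comp_apply, LinearMap.smul_apply, map_smul,
        hF.schwartzP_apply, schwartzX_schwartzCubic, hX]
    · rw [zero_add, norm_mul, norm_mul, norm_mul, hs, ha, Complex.norm_real, Real.norm_eq_abs,
        one_mul, ← pow_add, ← pow_succ']
      congr 1
      -- The exponents satisfy `1 + 2(2^t - 1) = 2^(t+1) - 1`; positivity of `2^t` guards the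
      -- truncated subtraction.
      have := Nat.one_le_two_pow (n := t)
      rw [pow_succ]
      omega

lemma exists_energy_ge {F : Mode ≃ₗᵢ[ℂ] Mode} (hF : F = fourierGate ∨ F = fourierGate⁻¹)
    (θ : ℝ) (t : ℕ) : ∃ E : ℝ, HasEnergy (circuit F θ t vacuum) E ∧
      (2 ^ t).factorial * (θ ^ 2) ^ (2 ^ t - 1) / 2 ^ (2 ^ t + 1) - 1 / 2 ≤ E := by
  obtain ⟨G, s, hG⟩ := exists_rotatesQuadratures hF
  obtain ⟨U, A, B, a, b, hU, hX, -, hA, -, ha⟩ := exists_heisenberg_quadratures hG θ t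
  -- The vacuum is the polynomial state of the constant 1, of degree 0.
  obtain ⟨q, hq₁, hq₂, hq₃⟩ := hA 0 1 (by simp)
  rw [zero_add] at hq₁ hq₂
  rw [Polynomial.coeff_one_zero, mul_one] at hq₂
  rw [polyState_one] at hq₃
  have hE := hasEnergy_schwartzState (U schwartzVacuum)
  rw [← hU, schwartzState_schwartzVacuum] at hE
  refine ⟨_, hE, ?_⟩
  have h₁ : ‖circuit F θ t vacuum‖ ^ 2 = 1 := by
    have h := inner_schwartzVacuum
    rw [schwartzState_schwartzVacuum, inner_self_eq_norm_sq_to_K] at h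
    rw [LinearIsometryEquiv.norm_map]
    simp only [Complex.coe_algebraMap] at h
    exact_mod_cast h
  have h₂ := factorial_mul_norm_coeff_sq_le (2 ^ t) q hq₁
  rw [hq₂, ha, ← pow_mul, mul_comm _ 2, pow_mul, sq_abs] at h₂
  have h₃ : ‖schwartzState (schwartzX (U schwartzVacuum))‖ = ‖schwartzState (polyState q)‖ := by
    rw [hX, ← hU, LinearIsometryEquiv.norm_map, hq₃]
  have h₄ : ((2 ^ t).factorial * (θ ^ 2) ^ (2 ^ t - 1) / 2 ^ (2 ^ t + 1) : ℝ)
      ≤ ‖schwartzState (polyState q)‖ ^ 2 / 2 := by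
    rw [pow_succ 2 (2 ^ t), ← div_div]
    gcongr
    rw [div_le_iff₀ (by positivity)]
    linarith
  rw [h₁, h₃]
  -- The momentum contribution is nonnegative and is dropped.
  linarith [sq_nonneg ‖schwartzState (schwartzP (U schwartzVacuum))‖]

/-! ### Double-exponential growth -/

/-- With `n = 2^t` one has `2^(t 2^t) = n^n`, and `n^n / n! ≤ e^n` because the left side is one term
of the exponential series. -/
lemma lower_bound_le (θ : ℝ) (t : ℕ) :
    1 / (4 * Real.exp 1) * (θ ^ 2 / (2 * Real.exp 1)) ^ (2 ^ t - 1) * 2 ^ (t * 2 ^ t)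
      ≤ (2 ^ t).factorial * (θ ^ 2) ^ (2 ^ t - 1) / 2 ^ (2 ^ t + 1) := by
  obtain ⟨m, hm⟩ : ∃ m, 2 ^ t = m + 1 := ⟨2 ^ t - 1, by have := Nat.one_le_two_pow (n := t); omega⟩
  have h₁ : (2 : ℝ) ^ (t * 2 ^ t) = ((m + 1 : ℕ) : ℝ) ^ (m + 1) := by
    rw [← hm]
    push_cast
    rw [← pow_mul]
  have h₂ := Real.pow_div_factorial_le_exp ((m + 1 : ℕ) : ℝ) (by positivity) (m + 1)
  rw [div_le_iff₀ (by positivity), ← mul_one ((m + 1 : ℕ) : ℝ), Real.exp_nat_mul, mul_one] at h₂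
  rw [h₁, hm, Nat.add_sub_cancel]
  calc 1 / (4 * Real.exp 1) * (θ ^ 2 / (2 * Real.exp 1)) ^ m * ((m + 1 : ℕ) : ℝ) ^ (m + 1)
      ≤ 1 / (4 * Real.exp 1) * (θ ^ 2 / (2 * Real.exp 1)) ^ m
        * (Real.exp 1 ^ (m + 1) * (m + 1).factorial) := by gcongr
    _ = (m + 1).factorial * (θ ^ 2) ^ m / 2 ^ (m + 1 + 1) := by
      have := (Real.exp_pos 1).ne'
      rw [div_pow, mul_pow]
      field_simp
      ring

lemma eventually_pow_le_factorial_mul {r : ℝ} (hr : 0 < r) (C : ℝ) :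
    ∀ᶠ n : ℕ in Filter.atTop, C ^ n ≤ n.factorial * r ^ (n - 1) / 2 ^ (n + 1) - 1 / 2 := by
  have h₁ := FloorSemiring.tendsto_pow_div_factorial_atTop (2 * |C| / r)
  have h₂ := FloorSemiring.tendsto_pow_div_factorial_atTop (2 / r)
  -- The factors `1/2` and `2r` make this sum equal to `|C|^n + 1/2` divided by `n! r^(n-1) /
  -- 2^(n+1)`, as `h₃` records; its limit 0 brings it below 1.
  have h := (h₁.add (h₂.const_mul (1 / 2))).const_mul (2 * r)
  rw [mul_zero, add_zero, mul_zero] at h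
  filter_upwards [h.eventually_le_const one_pos, Filter.eventually_ge_atTop 1] with n hn hn₁
  obtain ⟨m, rfl⟩ : ∃ m, n = m + 1 := ⟨n - 1, by omega⟩
  have hC : C ^ (m + 1) ≤ |C| ^ (m + 1) := (le_abs_self _).trans_eq (abs_pow C _)
  have hf : (0 : ℝ) < (m + 1).factorial := by exact_mod_cast (m + 1).factorial_pos
  have h₃ : 2 * r * ((2 * |C| / r) ^ (m + 1) / (m + 1).factorial
      + 1 / 2 * ((2 / r) ^ (m + 1) / (m + 1).factorial))
      = (|C| ^ (m + 1) + 1 / 2) * (2 ^ (m + 1 + 1) / ((m + 1).factorial * r ^ m)) := by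
    rw [div_pow, div_pow, mul_pow]
    field_simp
    ring
  rw [h₃, ← mul_div_assoc, div_le_one (by positivity), ← le_div_iff₀ (by positivity)] at hn
  rw [Nat.add_sub_cancel]
  linarith

end CV

end

theorem mainTheorem12 (θ : ℝ) (F : CV.Mode ≃ₗᵢ[ℂ] CV.Mode)
    (hF : F = CV.fourierGate ∨ F = CV.fourierGate⁻¹) :
    ∃ E : ℕ → ℝ,
      (∀ t : ℕ, CV.HasEnergy (CV.circuit F θ t CV.vacuum) (E t)) ∧
      (∀ t : ℕ,
        1 / (4 * Real.exp 1) * (θ ^ 2 / (2 * Real.exp 1)) ^ (2 ^ t - 1) * 2 ^ (t * 2 ^ t) - 1 / 2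
          ≤ E t) ∧
      (θ ≠ 0 → ∀ C : ℝ, ∀ᶠ t : ℕ in Filter.atTop, C ^ (2 ^ t) ≤ E t) := by
  choose E hE hE' using CV.exists_energy_ge hF θ
  refine ⟨E, hE, fun t => le_trans (sub_le_sub_right (CV.lower_bound_le θ t) _) (hE' t),
    fun hθ C => ?_⟩
  -- The estimate in `n` is pulled back along `n = 2^t`. The factorial bound is used directly,
  -- without Stirling-type weakening.
  have h := (tendsto_pow_atTop_atTop_of_one_lt (one_lt_two (α := ℕ))).eventually
    (CV.eventually_pow_le_factorial_mul (sq_pos_of_ne_zero hθ) C)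
  filter_upwards [h] with t ht
  exact ht.trans (hE' t)
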